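/- Call a field $K$ absolute if every finite subset of $K$ generates, over the prime subfield, a finite field. Let $\mathscr{T}_K$ be the Toeplitz $K$-algebra, i.e. the Leavitt path algebra over $K$ of the directed graph with two vertices $u,v$ and two edges $e\colon u\to u$ and $f\colon u\to v$. Explicitly, $\mathscr{T}_K$ is the unital associative $K$-algebra generated by $u,v,e,f,e^*,f^*$ subject to the relations $u^2=u$, $v^2=v$, $uv=vu=0$, $u+v=1$; $ue=eu=e$, $uf=fv=f$; $ue^*=e^*u=e^*$, $vf^*=f^*u=f^*$; $e^*e=u$, $f^*f=v$, $e^*f=f^*e=0$; and $u=ee^*+ff^*$. If $K$ is a field that is not absolute, then every normal subgroup of the unit group $(\mathscr{T}_K)^\times$ that is not contained in the center of $(\mathscr{T}_K)^\times$ contains a non-cyclic free subgroup. -/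

import Mathlib

/-- A directed graph with vertex set `V`, edge set `E`, source map `s` and range map `r`. -/
structure DirectedGraph (V E : Type*) where
  s : E → V
  r : E → V

namespace DirectedGraph

/-- A vertex is regular if it emits at least one and only finitely many edges,
i.e. it is neither a sink nor an infinite emitter. -/
def IsRegular {V E : Type*} (G : DirectedGraph V E) (v : V) : Prop :=
  {e : E | G.s e = v}.Nonempty ∧ {e : E | G.s e = v}.Finite

end DirectedGraph

namespace LeavittPathAlgebra

/-- Generating symbols: vertices `v`, edges `e` and ghost edges `e*`. -/
inductive Gen (V E : Type*)
  | vertex (v : V) : Gen V E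
  | edge (e : E) : Gen V E
  | ghost (e : E) : Gen V E

section

variable (K : Type*) [Field K] {V E : Type*}

/-- A vertex as an element of the free algebra. -/
def vtx (v : V) : FreeAlgebra K (Gen V E) := FreeAlgebra.ι K (Gen.vertex v)

/-- An edge as an element of the free algebra. -/
def edg (e : E) : FreeAlgebra K (Gen V E) := FreeAlgebra.ι K (Gen.edge e)

/-- A ghost edge as an element of the free algebra. -/
def gst (e : E) : FreeAlgebra K (Gen V E) := FreeAlgebra.ι K (Gen.ghost e)

/-- The defining relations of the Leavitt path algebra of a graph with finitely many vertices.
All constructors but the last are the relations (V), (E1), (E2), (CK1), (CK2).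
`FreeAlgebra` is the *unital* free algebra, whereas Leavitt path algebras are quotients of the free
algebra without an adjoined unit; as there are finitely many vertices, the sum of all vertices
is the identity of the latter quotient, and the last relation identifies it with the
unit of `FreeAlgebra`. -/
inductive Rel [Fintype V] (G : DirectedGraph V E) :
    FreeAlgebra K (Gen V E) → FreeAlgebra K (Gen V E) → Prop
  | vertex_mul_self (v : V) : Rel G (vtx K v * vtx K v) (vtx K v)
  | vertex_mul_of_ne (v w : V) (h : v ≠ w) : Rel G (vtx K v * vtx K w) 0
  | source_mul_edge (e : E) : Rel G (vtx K (G.s e) * edg K e) (edg K e)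
  | edge_mul_range (e : E) : Rel G (edg K e * vtx K (G.r e)) (edg K e)
  | range_mul_ghost (e : E) : Rel G (vtx K (G.r e) * gst K e) (gst K e)
  | ghost_mul_source (e : E) : Rel G (gst K e * vtx K (G.s e)) (gst K e)
  | ghost_mul_edge_self (e : E) : Rel G (gst K e * edg K e) (vtx K (G.r e))
  | ghost_mul_edge_of_ne (e f : E) (h : e ≠ f) : Rel G (gst K e * edg K f) 0
  | regular (v : V) (h : G.IsRegular v) :
      Rel G (vtx K v) (∑ e ∈ h.2.toFinset, edg K e * gst K e)
  | sum_vertices : Rel G (∑ v : V, vtx K v) 1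

end

end LeavittPathAlgebra

/-- The (unital) Leavitt path algebra `L_K(G)` of a directed graph with finitely many vertices. -/
abbrev LeavittPathAlgebra (K : Type*) [Field K] {V E : Type*} [Fintype V]
    (G : DirectedGraph V E) : Type _ :=
  RingQuot (LeavittPathAlgebra.Rel K G)

/-- The two vertices of the Toeplitz graph. -/
inductive ToeplitzVertex
  | u : ToeplitzVertex
  | v : ToeplitzVertex
  deriving DecidableEq

instance : Fintype ToeplitzVertex where
  elems := {ToeplitzVertex.u, ToeplitzVertex.v}
  complete := fun x => by cases x <;> simp

/-- The two edges of the Toeplitz graph. -/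
inductive ToeplitzEdge
  | e : ToeplitzEdge
  | f : ToeplitzEdge

/-- The Toeplitz graph: a loop `e` at `u` and an edge `f` from `u` to `v`. -/
def toeplitzGraph : DirectedGraph ToeplitzVertex ToeplitzEdge where
  s := fun _ => ToeplitzVertex.u
  r := fun a => match a with
    | ToeplitzEdge.e => ToeplitzVertex.u
    | ToeplitzEdge.f => ToeplitzVertex.v

/-- The Toeplitz `K`-algebra, the Leavitt path algebra of the Toeplitz graph. -/
abbrev ToeplitzAlgebra (K : Type*) [Field K] : Type _ :=
  LeavittPathAlgebra K toeplitzGraph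

/-- A field is absolute (locally finite) if each of its finite subsets generates, over the
prime subfield, a finite field. -/
def IsAbsoluteField (K : Type*) [Field K] : Prop :=
  ∀ S : Finset K, Finite (Subfield.closure (S : Set K))

/-!
The Toeplitz algebra is generated by `a = e* + f*` and `b = e + f`, and `a b = 1`. The elements
`b ^ i (1 - b a) a ^ j` form an infinite system of matrix units, so that the algebra contains the
finitary matrices indexed by `ℕ`, and it is commutative modulo these.

Let `N` be a noncentral normal subgroup of the unit group. A nontrivial commutator of an element of
`N` lies in `N` and has the form `1 + m`, with `m ≠ 0` a finite matrix
(`exists_mem_sub_one_annihilated_by_pow`). Two further commutators, with transvections that involve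
rows and columns beyond the support of `m`, isolate a nonzero entry of `m` and move it to any
off-diagonal position beyond that support, with any scalar in its place. Hence `N` contains the
transvections of a 2-by-2 diagonal block (`exists_forall_transvection_mem`), and it remains to find
a free subgroup in a normal subgroup of `GL₂(K)` that contains all transvections.

If `K` is not absolute, then some element of `K` is not integral over `ℤ`, and so there are a
valuation on `K` and an element `t` with `|t| > 1` (`exists_notMem_valuationSubring`). The matrix
`diag(t², t⁻²)`, a product of transvections, attracts towards `∞` and, inversely, towards `0` on the
projective line. Its conjugate by `!![t, 1; 1, t]` has the fixed points `t` and `t⁻¹` instead, and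
the two freely generate a free group by the ping-pong lemma
(`injective_lift_conj_hyperbolicDiag`).
-/

/-! ### Valuations on fields that are not absolute -/

theorem isAbsoluteField_of_forall_isIntegral {K : Type*} [Field K]
    (h : ∀ x : K, IsIntegral ℤ x) : IsAbsoluteField K := by
  obtain ⟨p, hp⟩ := CharP.exists K
  rcases CharP.char_is_prime_or_zero K p with hprime | rfl
  · have := Fact.mk hprime
    let _ := ZMod.algebra K p
    intro S
    have : FiniteDimensional (ZMod p) (IntermediateField.adjoin (ZMod p) (S : Set K)) :=
      IntermediateField.finiteDimensional_adjoin fun x _ => (h x).tower_top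
    have hfin : Finite (IntermediateField.adjoin (ZMod p) (S : Set K)) :=
      Module.finite_of_finite (ZMod p)
    have hle : Subfield.closure (S : Set K) ≤
        (IntermediateField.adjoin (ZMod p) (S : Set K)).toSubfield :=
      Subfield.closure_le.2 (IntermediateField.subset_adjoin _ _)
    exact Finite.Set.subset _ hle
  · -- In characteristic zero the hypothesis fails: `1 / 2` is not an algebraic integer.
    have := CharP.charP_to_charZero K
    have h2 : IsIntegral ℤ (algebraMap ℚ K (1 / 2)) := h _
    rw [isIntegral_algebraMap_iff (algebraMap ℚ K).injective,
      IsIntegrallyClosed.isIntegral_iff] at h2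
    obtain ⟨n, hn⟩ := h2
    have h3 : (2 * n : ℚ) = 1 := by
      simp only [eq_intCast] at hn
      rw [hn]; norm_num
    have h4 : 2 * n = 1 := by exact_mod_cast h3
    omega

/-- A field that is not absolute carries a nontrivial valuation, because the intersection of all its
valuation subrings is the integral closure of the prime ring. -/
theorem exists_notMem_valuationSubring {K : Type*} [Field K] (hK : ¬ IsAbsoluteField K) :
    ∃ (V : ValuationSubring K) (t : K), t ∉ V := by
  by_contra! H
  refine hK (isAbsoluteField_of_forall_isIntegral fun x => ?_)
  have hx : x ∈ (integralClosure (Subring.closure (∅ : Set K)) K).toSubring := by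
    rw [← iInf_valuationSubring_superset, Subring.mem_iInf]
    exact fun V => H V.1 x
  have : Algebra.IsIntegral ℤ (Subring.closure (∅ : Set K)) := ⟨by
    rintro ⟨y, hy⟩
    rw [Subring.closure_empty, Subring.mem_bot] at hy
    obtain ⟨n, rfl⟩ := hy
    have := isIntegral_algebraMap (R := ℤ) (A := Subring.closure (∅ : Set K)) (x := n)
    convert this
    simp⟩
  exact isIntegral_trans (R := ℤ) (A := Subring.closure (∅ : Set K)) x hx

/-! ### Free subgroups of normal subgroups of `GL₂` -/

universe u

section PingPong

open scoped Pointwise Function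
open Matrix

variable {K : Type u} [Field K]

/-- The transvection with upper right entry `d`. -/
def upperTransvection (d : K) : GL (Fin 2) K :=
  ⟨!![1, d; 0, 1], !![1, -d; 0, 1], by simp [Matrix.one_fin_two], by simp [Matrix.one_fin_two]⟩

/-- The transvection with lower left entry `d`. -/
def lowerTransvection (d : K) : GL (Fin 2) K :=
  ⟨!![1, 0; d, 1], !![1, 0; -d, 1], by simp [Matrix.one_fin_two], by simp [Matrix.one_fin_two]⟩

/-- The diagonal matrix with entries `d` and `d⁻¹`. -/
def hyperbolicDiag (d : K) (hd : d ≠ 0) : GL (Fin 2) K :=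
  ⟨!![d, 0; 0, d⁻¹], !![d⁻¹, 0; 0, d], by simp [Matrix.one_fin_two, hd],
    by simp [Matrix.one_fin_two, hd]⟩

theorem hyperbolicDiag_mem {N : Subgroup (GL (Fin 2) K)}
    (hU : ∀ d, upperTransvection d ∈ N) (hL : ∀ d, lowerTransvection d ∈ N)
    (d : K) (hd : d ≠ 0) : hyperbolicDiag d hd ∈ N := by
  have h : hyperbolicDiag d hd =
      (upperTransvection d * lowerTransvection (-d⁻¹) * upperTransvection d) *
      (upperTransvection (-1) * lowerTransvection 1 * upperTransvection (-1)) := by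
    ext i j
    fin_cases i <;> fin_cases j <;>
      simp [hyperbolicDiag, upperTransvection, lowerTransvection, hd]
  rw [h]
  exact N.mul_mem (N.mul_mem (N.mul_mem (hU _) (hL _)) (hU _))
    (N.mul_mem (N.mul_mem (hU _) (hL _)) (hU _))

variable {Γ : Type*} [LinearOrderedCommGroupWithZero Γ] (v : Valuation K Γ)

/-- The matrices whose first column, read as a point `x / y` of the projective line, satisfies
`|x / y| > |s|`; a neighbourhood of `∞`. Letting `GL₂` act on itself instead of on the projective
line makes the action available from the group structure. -/
def attractingSet (s : K) : Set (GL (Fin 2) K) := {g | v (s * g.1 1 0) < v (g.1 0 0)}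

/-- The matrices whose first column `(x, y)` satisfies `|x / y| ≤ |s|⁻¹`; a neighbourhood of `0`. -/
def repellingSet (s : K) : Set (GL (Fin 2) K) := {g | v (s * g.1 0 0) ≤ v (g.1 1 0)}

theorem hyperbolicDiag_smul_compl_subset (d : K) (hd : d ≠ 0) :
    hyperbolicDiag d hd • (repellingSet v d)ᶜ ⊆ attractingSet v d := by
  rintro _ ⟨g, hg, rfl⟩
  simpa [hyperbolicDiag, attractingSet, repellingSet, Matrix.mul_apply, Fin.sum_univ_two, hd]
    using hg

theorem hyperbolicDiag_inv_smul_compl_subset (d : K) (hd : d ≠ 0) :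
    (hyperbolicDiag d hd)⁻¹ • (attractingSet v d)ᶜ ⊆ repellingSet v d := by
  rintro _ ⟨g, hg, rfl⟩
  have : ((hyperbolicDiag d hd)⁻¹ : GL (Fin 2) K).1 = !![d⁻¹, 0; 0, d] := rfl
  simpa [this, attractingSet, repellingSet, Matrix.mul_apply, Fin.sum_univ_two, hd]
    using hg

theorem firstColumn_ne_zero (g : GL (Fin 2) K) : g.1 0 0 ≠ 0 ∨ g.1 1 0 ≠ 0 := by
  by_contra! H
  have := (Matrix.isUnit_iff_isUnit_det _).1 g.isUnit
  simp [Matrix.det_fin_two, H.1, H.2] at this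

/-- A matrix moving the fixed points `∞` and `0` of a diagonal matrix to `t` and `t⁻¹`. For
`|t| > 1` these lie outside the neighbourhoods `|z| > |t|²` and `|z| ≤ |t|⁻²` of `∞` and `0`. Fixed
points with integral coordinates would not do in general, as the residue field may have only two
elements. -/
def axisMovingMatrix (t : K) (ht : t ^ 2 - 1 ≠ 0) : GL (Fin 2) K :=
  Matrix.GeneralLinearGroup.mkOfDetNeZero !![t, 1; 1, t]
    (by simpa [Matrix.det_fin_two, sq] using ht)

theorem disjoint_attractingSet_repellingSet {t : K} (ht : 1 < v t) :
    Disjoint (attractingSet v (t ^ 2)) (repellingSet v (t ^ 2)) := by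
  rw [Set.disjoint_left]
  intro g h1 h2
  simp only [attractingSet, repellingSet, Set.mem_ofPred_eq, map_mul, map_pow] at h1 h2
  have h3 : 1 < v t ^ 2 := one_lt_pow₀ ht two_ne_zero
  have h4 := le_mul_of_one_le_left' h3.le (a := v (g.1 1 0))
  have h5 := le_mul_of_one_le_left' h3.le (a := v (g.1 0 0))
  exact absurd (h5.trans (h2.trans h4)) h1.not_ge

/-- The axis-moving matrix carries the two neighbourhoods into the annulus between them: if
`|x| > |t y|` then `|t x + y| = |t| |x|` and `|t y + x| = |x|`, and symmetrically. -/
theorem axisMovingMatrix_smul_notMem {t : K} (ht : 1 < v t) (ht' : t ^ 2 - 1 ≠ 0)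
    {g : GL (Fin 2) K} (hg : g ∈ attractingSet v (t ^ 2) ∪ repellingSet v (t ^ 2)) :
    axisMovingMatrix t ht' • g ∉ attractingSet v (t ^ 2) ∪ repellingSet v (t ^ 2) := by
  have h0 := firstColumn_ne_zero g
  have e0 : (axisMovingMatrix t ht' • g).1 0 0 = t * g.1 0 0 + g.1 1 0 := by
    simp [axisMovingMatrix, Matrix.mul_apply, Fin.sum_univ_two, GeneralLinearGroup.mkOfDetNeZero]
  have e1 : (axisMovingMatrix t ht' • g).1 1 0 = t * g.1 1 0 + g.1 0 0 := by
    simp [axisMovingMatrix, Matrix.mul_apply, Fin.sum_univ_two, GeneralLinearGroup.mkOfDetNeZero,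
      add_comm]
  simp only [attractingSet, repellingSet, Set.mem_union, Set.mem_ofPred_eq, not_or, not_lt,
    not_le] at hg ⊢
  rw [e0, e1]
  generalize g.1 0 0 = x at *
  generalize g.1 1 0 = y at *
  have h3 : v t < v t ^ 2 := by
    rw [sq]; exact (lt_mul_iff_one_lt_left (zero_lt_one.trans ht)).2 ht
  have key : ∀ x y : K, x ≠ 0 → v (t * y) < v x →
      v (t * x + y) < v (t ^ 2 * (t * y + x)) ∧ v (t * y + x) < v (t ^ 2 * (t * x + y)) := by
    intro x y hx hxy
    have hvx : 0 < v x := (Valuation.pos_iff v).2 hx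
    have e1 : v (t * y + x) = v x := Valuation.map_add_eq_of_lt_right v hxy
    have hy : v y < v (t * x) := by
      rw [map_mul] at *
      calc v y ≤ v t * v y := le_mul_of_one_le_left' ht.le
        _ < v x := hxy
        _ ≤ v t * v x := le_mul_of_one_le_left' ht.le
    have e2 : v (t * x + y) = v t * v x := by
      rw [Valuation.map_add_eq_of_lt_left v hy, map_mul]
    rw [map_mul, map_mul, e1, e2, map_pow]
    refine ⟨mul_lt_mul_of_pos_right h3 hvx, ?_⟩
    rw [← mul_assoc, ← pow_succ]
    exact (lt_mul_iff_one_lt_left hvx).2 (one_lt_pow₀ ht three_ne_zero)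
  rcases hg with hg | hg
  · have hx : x ≠ 0 := by
      rintro rfl
      simp at hg
    have h := key x y hx (lt_of_le_of_lt ?_ hg)
    · exact ⟨h.1.le, h.2⟩
    · rw [map_mul, map_mul, map_pow]
      exact mul_le_mul_left h3.le _
  · have hy : y ≠ 0 := by
      rintro rfl
      have ht0 : t ≠ 0 := by rintro rfl; simp at ht
      simp [ht0] at hg
      simp [hg] at h0
    have h := key y x hy ?_
    · exact ⟨h.2.le, h.1⟩
    · rcases eq_or_ne x 0 with rfl | hx
      · simpa using (Valuation.pos_iff v).2 hy
      · refine lt_of_lt_of_le ?_ hg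
        rw [map_mul, map_mul, map_pow]
        exact mul_lt_mul_of_pos_right h3 ((Valuation.pos_iff v).2 hx)

/-- Ping-pong for a hyperbolic diagonal matrix and its conjugate by the axis-moving matrix. The
index type is lifted since `FreeGroup.injective_lift_of_ping_pong` wants it in the universe of the
group. -/
theorem injective_lift_conj_hyperbolicDiag {t : K} (ht : 1 < v t) (ht0 : t ^ 2 ≠ 0)
    (ht' : t ^ 2 - 1 ≠ 0) :
    Function.Injective (FreeGroup.lift fun i : ULift.{u} Bool =>
      cond i.down (axisMovingMatrix t ht') 1 * hyperbolicDiag (t ^ 2) ht0 *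
        (cond i.down (axisMovingMatrix t ht') 1)⁻¹) := by
  set C := axisMovingMatrix t ht'
  set D := hyperbolicDiag (t ^ 2) ht0
  set A := attractingSet v (t ^ 2)
  set R := repellingSet v (t ^ 2)
  have hAR : Disjoint A R := disjoint_attractingSet_repellingSet v ht
  have hdisj : Disjoint (A ∪ R) (C • (A ∪ R)) := by
    rw [Set.disjoint_right]
    rintro _ ⟨g, hg, rfl⟩
    exact axisMovingMatrix_smul_notMem v ht ht' hg
  have hAA : Disjoint A (C • A) := hdisj.mono Set.subset_union_left
    (Set.smul_set_mono Set.subset_union_left)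
  have hRR : Disjoint R (C • R) := hdisj.mono Set.subset_union_right
    (Set.smul_set_mono Set.subset_union_right)
  have hAR' : Disjoint A (C • R) := hdisj.mono Set.subset_union_left
    (Set.smul_set_mono Set.subset_union_right)
  have hRA : Disjoint R (C • A) := hdisj.mono Set.subset_union_right
    (Set.smul_set_mono Set.subset_union_left)
  refine FreeGroup.injective_lift_of_ping_pong _
    (fun i => (cond i.down C 1) • A)
    (fun i => (cond i.down C 1) • R) ?_ ?_ ?_ ?_ ?_ ?_
  · intro i
    have hA : A.Nonempty := ⟨1, by simp [A, attractingSet]⟩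
    exact hA.smul_set (a := cond i.down C 1)
  · rintro ⟨_ | _⟩ ⟨_ | _⟩ h
    · exact absurd rfl h
    · simpa [Function.onFun] using hAA
    · simpa [Function.onFun] using hAA.symm
    · exact absurd rfl h
  · rintro ⟨_ | _⟩ ⟨_ | _⟩ h
    · exact absurd rfl h
    · simpa [Function.onFun] using hRR
    · simpa [Function.onFun] using hRR.symm
    · exact absurd rfl h
  · rintro ⟨_ | _⟩ ⟨_ | _⟩
    · simpa using hAR
    · simpa using hAR'
    · simpa using hRA.symm
    · exact (Set.disjoint_smul_set (a := C)).2 hAR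
  · intro i
    rw [← Set.smul_set_compl, smul_smul, inv_mul_cancel_right, mul_smul]
    exact Set.smul_set_mono (hyperbolicDiag_smul_compl_subset v _ ht0)
  · intro i
    rw [← Set.smul_set_compl, smul_smul, Pi.inv_apply, _root_.mul_inv_rev, _root_.mul_inv_rev, inv_inv,
      mul_assoc, inv_mul_cancel_right, mul_smul]
    exact Set.smul_set_mono (hyperbolicDiag_inv_smul_compl_subset v _ ht0)

end PingPong

theorem exists_free_subgroup_of_transvections_mem {K : Type u} [Field K] (hK : ¬ IsAbsoluteField K)
    (N : Subgroup (GL (Fin 2) K)) [hN : N.Normal]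
    (hU : ∀ d, upperTransvection d ∈ N) (hL : ∀ d, lowerTransvection d ∈ N) :
    ∃ f : FreeGroup (ULift.{u} Bool) →* GL (Fin 2) K, Function.Injective f ∧ f.range ≤ N := by
  obtain ⟨V, t, ht⟩ := exists_notMem_valuationSubring hK
  have hv : 1 < V.valuation t := by rwa [← not_le, V.valuation_le_one_iff]
  have ht0 : t ^ 2 ≠ 0 := by
    refine pow_ne_zero 2 ?_
    rintro rfl
    exact ht V.zero_mem
  have ht' : t ^ 2 - 1 ≠ 0 := fun h => by
    have h1 : V.valuation t ^ 2 = 1 := by rw [← map_pow, sub_eq_zero.1 h, map_one]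
    exact (one_lt_pow₀ hv two_ne_zero).ne' h1
  refine ⟨_, injective_lift_conj_hyperbolicDiag V.valuation hv ht0 ht', ?_⟩
  rw [MonoidHom.range_eq_map, Subgroup.map_le_iff_le_comap, ← FreeGroup.closure_range_of,
    Subgroup.closure_le]
  rintro _ ⟨i, rfl⟩
  rw [SetLike.mem_coe, Subgroup.mem_comap, FreeGroup.lift_apply_of]
  exact hN.conj_mem _ (hyperbolicDiag_mem hU hL _ ht0) _

theorem isFreeGroup_range_and_not_isCyclic {α G : Type*} [Nontrivial α] [Group G]
    (f : FreeGroup α →* G) (hf : Function.Injective f) :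
    IsFreeGroup f.range ∧ ¬ IsCyclic f.range := by
  refine ⟨IsFreeGroup.ofMulEquiv (MonoidHom.ofInjective hf), fun h => ?_⟩
  classical
  obtain ⟨x, y, hxy⟩ := exists_pair_ne α
  have h1 : FreeGroup.of x * FreeGroup.of y = FreeGroup.of y * FreeGroup.of x := by
    apply (MonoidHom.ofInjective hf).injective
    simp only [map_mul]
    exact mul_comm' _ _
  -- Two transpositions in the symmetric group on three letters do not commute.
  have h2 := congrArg (FreeGroup.lift fun z => if z = x then Equiv.swap (0 : Fin 3) 1
    else Equiv.swap 1 2) h1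
  simp only [map_mul, FreeGroup.lift_apply_of, if_true, if_neg hxy.symm] at h2
  exact absurd h2 (by decide)

/-! ### Algebras generated by a one-sided inverse pair -/

section Jacobson

variable {K T : Type*} [Field K] [Ring T] [Algebra K T] {a b : T}

theorem pow_add_mul_mul_eq {n m : ℕ} {x y : T} (hn : a ^ n * x ∈ Algebra.adjoin K {a}) :
    a ^ (m + n) * (x * y) = a ^ n * x * (a ^ m * y) := by
  have h : a ^ m * (a ^ n * x) = a ^ n * x * a ^ m :=
    Algebra.commute_of_mem_adjoin_singleton_of_commute hn ((Commute.refl a).pow_left m)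
  rw [pow_add, ← mul_assoc, mul_assoc (a ^ m), h, mul_assoc]

/-- Multiplying by a high power of `a` cancels every `b`, so that only a polynomial in `a` is left. -/
theorem exists_pow_mul_mem_adjoin (hab : a * b = 1) (hgen : Algebra.adjoin K {a, b} = ⊤) (x : T) :
    ∃ n : ℕ, a ^ n * x ∈ Algebra.adjoin K {a} := by
  have ha : ∀ n, a ^ n ∈ Algebra.adjoin K {a} := fun n =>
    pow_mem (Algebra.self_mem_adjoin_singleton K a) n
  have hx : x ∈ Algebra.adjoin K {a, b} := hgen ▸ Algebra.mem_top
  induction hx using Algebra.adjoin_induction with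
  | mem x hx =>
    rcases hx with rfl | rfl
    · exact ⟨0, by simp⟩
    · exact ⟨1, by simp [hab]⟩
  | algebraMap r => exact ⟨0, by simp⟩
  | add x y _ _ hx hy =>
    obtain ⟨n, hn⟩ := hx
    obtain ⟨m, hm⟩ := hy
    refine ⟨n + m, ?_⟩
    have : a ^ (n + m) * (x + y) = a ^ m * (a ^ n * x) + a ^ n * (a ^ m * y) := by
      rw [mul_add, ← mul_assoc, ← mul_assoc, ← pow_add, ← pow_add, add_comm m]
    rw [this]
    exact add_mem (mul_mem (ha m) hn) (mul_mem (ha n) hm)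
  | mul x y _ _ hx hy =>
    obtain ⟨n, hn⟩ := hx
    obtain ⟨m, hm⟩ := hy
    refine ⟨m + n, ?_⟩
    rw [pow_add_mul_mul_eq hn]
    exact mul_mem hn hm

/-- After multiplication by a high power of `a`, both `x` and `y` are polynomials in `a`, and these
commute. -/
theorem exists_pow_mul_commutator_eq_zero (hab : a * b = 1)
    (hgen : Algebra.adjoin K {a, b} = ⊤) (x y : T) : ∃ n : ℕ, a ^ n * (x * y - y * x) = 0 := by
  obtain ⟨n, hn⟩ := exists_pow_mul_mem_adjoin (K := K) hab hgen x
  obtain ⟨m, hm⟩ := exists_pow_mul_mem_adjoin (K := K) hab hgen y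
  refine ⟨m + n, ?_⟩
  rw [mul_sub, pow_add_mul_mul_eq hn, add_comm m n, pow_add_mul_mul_eq hm, sub_eq_zero]
  exact Algebra.commute_of_mem_adjoin_singleton_of_commute hm
    (Algebra.commute_of_mem_adjoin_self hn).symm

theorem exists_commutator_mul_pow_eq_zero (hab : a * b = 1)
    (hgen : Algebra.adjoin K {a, b} = ⊤) (x y : T) : ∃ n : ℕ, (x * y - y * x) * b ^ n = 0 := by
  have hab' : MulOpposite.op b * MulOpposite.op a = 1 := by rw [← MulOpposite.op_mul, hab]; rfl
  have hgen' : Algebra.adjoin K {MulOpposite.op b, MulOpposite.op a} = ⊤ := by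
    have h := Subalgebra.op_adjoin (R := K) ({a, b} : Set T)
    rw [hgen, Subalgebra.op_top] at h
    rw [h]
    congr 1
    ext x
    simp only [Set.mem_insert_iff, Set.mem_singleton_iff, Set.mem_preimage, or_comm,
      ← MulOpposite.unop_inj, MulOpposite.unop_op]
  obtain ⟨n, hn⟩ := exists_pow_mul_commutator_eq_zero hab' hgen' (MulOpposite.op y) (MulOpposite.op x)
  exact ⟨n, MulOpposite.op_injective (by simpa using hn)⟩

variable (a b)

/-- The idempotent complementary to `b * a`. -/
def defect : T := 1 - b * a

/-- The matrix unit in position `(i, j)`, with rows and columns numbered by `ℕ`. -/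
def matrixUnit (i j : ℕ) : T := b ^ i * defect a b * a ^ j

variable {a b}

theorem mul_defect (hab : a * b = 1) : a * defect a b = 0 := by
  rw [defect, mul_sub, ← mul_assoc, hab, mul_one, one_mul, sub_self]

theorem defect_mul (hab : a * b = 1) : defect a b * b = 0 := by
  rw [defect, sub_mul, mul_assoc, hab, mul_one, one_mul, sub_self]

theorem defect_mul_self (hab : a * b = 1) : defect a b * defect a b = defect a b := by
  nth_rw 1 [defect]
  rw [sub_mul, one_mul, mul_assoc, mul_defect hab, mul_zero, sub_zero]

theorem pow_mul_pow_self (hab : a * b = 1) (n : ℕ) : a ^ n * b ^ n = 1 := by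
  induction n with
  | zero => simp
  | succ n ih => rw [pow_succ, pow_succ', mul_assoc, ← mul_assoc a, hab, one_mul, ih]

theorem pow_mul_defect (hab : a * b = 1) {n : ℕ} (hn : n ≠ 0) : a ^ n * defect a b = 0 := by
  obtain ⟨n, rfl⟩ := Nat.exists_eq_succ_of_ne_zero hn
  rw [pow_succ, mul_assoc, mul_defect hab, mul_zero]

theorem defect_mul_pow (hab : a * b = 1) {n : ℕ} (hn : n ≠ 0) : defect a b * b ^ n = 0 := by
  obtain ⟨n, rfl⟩ := Nat.exists_eq_succ_of_ne_zero hn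
  rw [pow_succ', ← mul_assoc, defect_mul hab, zero_mul]

theorem defect_mul_pow_mul_pow_mul_defect (hab : a * b = 1) (i j : ℕ) :
    defect a b * a ^ i * (b ^ j * defect a b) = if i = j then defect a b else 0 := by
  rcases lt_trichotomy i j with h | rfl | h
  · obtain ⟨k, rfl⟩ := Nat.exists_eq_add_of_lt h
    rw [if_neg (by omega), add_assoc, pow_add, mul_assoc (b ^ i), mul_assoc, ← mul_assoc (a ^ i),
      pow_mul_pow_self hab, one_mul, ← mul_assoc, defect_mul_pow hab (by omega), zero_mul]
  · rw [if_pos rfl, mul_assoc, ← mul_assoc (a ^ i), pow_mul_pow_self hab, one_mul,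
      defect_mul_self hab]
  · obtain ⟨k, rfl⟩ := Nat.exists_eq_add_of_lt h
    rw [if_neg (by omega), add_assoc, add_comm j, pow_add, mul_assoc, mul_assoc (a ^ _),
      ← mul_assoc (a ^ j), pow_mul_pow_self hab, one_mul, pow_mul_defect hab (by omega), mul_zero]

theorem matrixUnit_mul_matrixUnit (hab : a * b = 1) (i j k l : ℕ) :
    matrixUnit a b i j * matrixUnit a b k l = if j = k then matrixUnit a b i l else 0 := by
  have h : matrixUnit a b i j * matrixUnit a b k l =
      b ^ i * (defect a b * a ^ j * (b ^ k * defect a b)) * a ^ l := by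
    simp only [matrixUnit, mul_assoc]
  rw [h, defect_mul_pow_mul_pow_mul_defect hab]
  split_ifs
  · rfl
  · simp

theorem matrixUnit_ne_zero (hab : a * b = 1) (hv : defect a b ≠ 0) (i j : ℕ) :
    matrixUnit a b i j ≠ 0 := by
  intro h
  apply hv
  calc defect a b = a ^ i * b ^ i * defect a b * (a ^ j * b ^ j) := by
        simp [pow_mul_pow_self hab]
    _ = a ^ i * matrixUnit a b i j * b ^ j := by simp only [matrixUnit, mul_assoc]
    _ = 0 := by rw [h, mul_zero, zero_mul]

/-- Normal form in the bicyclic monoid. -/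
theorem exists_eq_pow_mul_pow_of_mem_closure (hab : a * b = 1) {x : T} (hx : x ∈ Submonoid.closure {a, b}) :
    ∃ i j : ℕ, x = b ^ i * a ^ j := by
  induction hx using Submonoid.closure_induction_left with
  | one => exact ⟨0, 0, by simp⟩
  | mul_left x hx y _ ih =>
    obtain ⟨i, j, rfl⟩ := ih
    rcases hx with rfl | rfl
    · rcases i with _ | i
      · exact ⟨0, j + 1, by simp [pow_succ']⟩
      · exact ⟨i, j, by rw [pow_succ', mul_assoc b, ← mul_assoc x, hab, one_mul]⟩
    · exact ⟨i + 1, j, by rw [pow_succ', mul_assoc]⟩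

/-- The corner at the defect is spanned by the defect over `K`. -/
theorem exists_defect_mul_mul_defect_eq_smul (hab : a * b = 1)
    (hgen : Algebra.adjoin K {a, b} = ⊤) (x : T) :
    ∃ c : K, defect a b * x * defect a b = c • defect a b := by
  have hx : x ∈ Submodule.span K (Submonoid.closure {a, b} : Set T) := by
    rw [← Algebra.adjoin_eq_span (R := K), hgen]
    exact Algebra.mem_top (R := K)
  induction hx using Submodule.span_induction with
  | mem x hx =>
    obtain ⟨i, j, rfl⟩ := exists_eq_pow_mul_pow_of_mem_closure hab hx
    rcases eq_or_ne i 0 with rfl | hi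
    · rcases eq_or_ne j 0 with rfl | hj
      · exact ⟨1, by simp [defect_mul_self hab]⟩
      · exact ⟨0, by simp [mul_assoc, pow_mul_defect hab hj]⟩
    · exact ⟨0, by simp [← mul_assoc, defect_mul_pow hab hi]⟩
  | zero => exact ⟨0, by simp⟩
  | add x y _ _ hx hy =>
    obtain ⟨c, hc⟩ := hx
    obtain ⟨d, hd⟩ := hy
    exact ⟨c + d, by rw [mul_add, add_mul, hc, hd, add_smul]⟩
  | smul r x _ hx =>
    obtain ⟨c, hc⟩ := hx
    exact ⟨r * c, by rw [mul_smul_comm, smul_mul_assoc, hc, mul_smul]⟩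

/-- An element killed by a power of `a` is determined by its rows: if they all vanish, then
`b * a` acts on each `a ^ n * x` as the identity, and so `x = b ^ n * a ^ n * x`. -/
theorem eq_zero_of_defect_mul_pow_mul {x : T} (h : ∀ i, defect a b * a ^ i * x = 0) {n : ℕ}
    (hn : a ^ n * x = 0) : x = 0 := by
  have key : ∀ n, b ^ n * (a ^ n * x) = x := by
    intro n
    induction n with
    | zero => simp
    | succ n ih =>
      have h1 : b * (a * (a ^ n * x)) = a ^ n * x := by
        have h2 := h n
        rw [defect, sub_mul, sub_mul, one_mul, sub_eq_zero] at h2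
        rw [← mul_assoc, ← mul_assoc, ← h2]
      rw [pow_succ, pow_succ', mul_assoc, mul_assoc, h1, ih]
  rw [← key n, hn, mul_zero]

theorem eq_zero_of_mul_pow_mul_defect {x : T} (h : ∀ j, x * (b ^ j * defect a b) = 0) {n : ℕ}
    (hn : x * b ^ n = 0) : x = 0 := by
  have key : ∀ n, x * b ^ n * a ^ n = x := by
    intro n
    induction n with
    | zero => simp
    | succ n ih =>
      have h1 : x * b ^ n * b * a = x * b ^ n := by
        have h2 := h n
        rw [defect, mul_sub, mul_sub, mul_one, sub_eq_zero] at h2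
        rw [mul_assoc, mul_assoc, ← h2]
      rw [pow_succ, pow_succ', ← mul_assoc, ← mul_assoc, h1, ih]
  rw [← key n, hn, zero_mul]

/-- A nonzero element killed by a power of `a` on the left and by a power of `b` on the right has a
nonzero matrix entry `c`, in position `(i, j)`. -/
theorem exists_entry_ne_zero (hab : a * b = 1) (hgen : Algebra.adjoin K {a, b} = ⊤) {m : T}
    (hm : m ≠ 0) {n₁ n₂ : ℕ} (h₁ : a ^ n₁ * m = 0) (h₂ : m * b ^ n₂ = 0) :
    ∃ i j : ℕ, ∃ c : K, c • defect a b ≠ 0 ∧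
      defect a b * a ^ i * m * (b ^ j * defect a b) = c • defect a b := by
  obtain ⟨i, hi⟩ : ∃ i, defect a b * a ^ i * m ≠ 0 := by
    by_contra! H
    exact hm (eq_zero_of_defect_mul_pow_mul H h₁)
  obtain ⟨j, hj⟩ : ∃ j, defect a b * a ^ i * m * (b ^ j * defect a b) ≠ 0 := by
    by_contra! H
    exact hi (eq_zero_of_mul_pow_mul_defect H (n := n₂) (by rw [mul_assoc, h₂, mul_zero]))
  obtain ⟨c, hc⟩ := exists_defect_mul_mul_defect_eq_smul (K := K) hab hgen (a ^ i * m * b ^ j)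
  have hc' : defect a b * a ^ i * m * (b ^ j * defect a b) = c • defect a b := by
    rw [← hc]
    simp only [mul_assoc]
  exact ⟨i, j, c, hc' ▸ hj, hc'⟩

end Jacobson

/-! ### Commutators in normal subgroups of unit groups -/

/-- The value `w` of the commutator of `g` and `h` is specified by `g h = w h g`, which avoids
computing inverses. -/
theorem Subgroup.Normal.exists_mem_val_eq_of_mul_eq {R : Type*} [Monoid R] {N : Subgroup Rˣ}
    (hN : N.Normal) {g : Rˣ} (hg : g ∈ N) (h : Rˣ) {w : R}
    (hw : (g * h : R) = w * (h * g)) : ∃ u ∈ N, (u : R) = w := by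
  refine ⟨g * (h * g⁻¹ * h⁻¹), N.mul_mem hg (hN.conj_mem _ (N.inv_mem hg) h), ?_⟩
  simp only [Units.val_mul]
  rw [← mul_assoc, ← mul_assoc, hw]
  simp [mul_assoc]

/-- The version of `Subgroup.Normal.exists_mem_val_eq_of_mul_eq` for the commutator of `h` and `g`. -/
theorem Subgroup.Normal.exists_mem_val_eq_of_mul_eq' {R : Type*} [Monoid R] {N : Subgroup Rˣ}
    (hN : N.Normal) {g : Rˣ} (hg : g ∈ N) (h : Rˣ) {w : R}
    (hw : (h * g : R) = w * (g * h)) : ∃ u ∈ N, (u : R) = w := by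
  refine ⟨h * g * h⁻¹ * g⁻¹, N.mul_mem (hN.conj_mem _ hg h) (N.inv_mem hg), ?_⟩
  simp only [Units.val_mul]
  rw [hw]
  simp [mul_assoc]

/-- The unit `1 + x`, where `x` squares to zero. -/
def unitOneAdd {R : Type*} [Ring R] (x : R) (hx : x * x = 0) : Rˣ :=
  ⟨1 + x, 1 - x, by noncomm_ring; simp [hx], by noncomm_ring; simp [hx]⟩

section Jacobson

variable {K T : Type*} [Field K] [Ring T] [Algebra K T] {a b : T}

/-- A commutator of a non-central element of `N` differs from `1` by a nonzero finite matrix: one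
that is killed by a power of `a` on the left and by a power of `b` on the right. -/
theorem exists_mem_sub_one_annihilated_by_pow (hab : a * b = 1) (hgen : Algebra.adjoin K {a, b} = ⊤)
    {N : Subgroup Tˣ} (hN : N.Normal) (hNc : ¬ N ≤ Subgroup.center Tˣ) :
    ∃ k ∈ N, (k : T) - 1 ≠ 0 ∧ (∃ n, a ^ n * ((k : T) - 1) = 0) ∧
      ∃ n, ((k : T) - 1) * b ^ n = 0 := by
  obtain ⟨g, hg, hgc⟩ := SetLike.not_le_iff_exists.1 hNc
  rw [Subgroup.mem_center_iff] at hgc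
  push Not at hgc
  obtain ⟨h, hh⟩ := hgc
  refine ⟨g * (h * g⁻¹ * h⁻¹), N.mul_mem hg (hN.conj_mem _ (N.inv_mem hg) h), ?_, ?_, ?_⟩
  · intro H
    have : g * (h * g⁻¹ * h⁻¹) = 1 := Units.ext (sub_eq_zero.1 H)
    apply hh
    rw [← mul_assoc, ← mul_assoc, mul_inv_eq_one, mul_inv_eq_iff_eq_mul] at this
    exact this.symm
  · obtain ⟨n, hn⟩ := exists_pow_mul_commutator_eq_zero (K := K) hab hgen (g : T) h
    refine ⟨n, ?_⟩
    have : ((g * (h * g⁻¹ * h⁻¹) : Tˣ) : T) - 1 =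
        ((g : T) * h - h * g) * ((g⁻¹ : Tˣ) * (h⁻¹ : Tˣ)) := by
      simp [sub_mul, mul_assoc]
    rw [this, ← mul_assoc, hn, zero_mul]
  · obtain ⟨n, hn⟩ :=
      exists_commutator_mul_pow_eq_zero (K := K) hab hgen ((g⁻¹ : Tˣ) : T) (h⁻¹ : Tˣ)
    refine ⟨n, ?_⟩
    have : ((g * (h * g⁻¹ * h⁻¹) : Tˣ) : T) - 1 =
        g * h * (((g⁻¹ : Tˣ) : T) * (h⁻¹ : Tˣ) - (h⁻¹ : Tˣ) * (g⁻¹ : Tˣ)) := by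
      simp [mul_sub, mul_assoc]
    rw [this, mul_assoc, hn, mul_zero]

/-- A noncentral normal subgroup contains all transvections in off-diagonal positions whose row and
column are large enough. -/
theorem exists_forall_transvection_mem (hab : a * b = 1) (hgen : Algebra.adjoin K {a, b} = ⊤)
    {N : Subgroup Tˣ} (hN : N.Normal) (hNc : ¬ N ≤ Subgroup.center Tˣ) :
    defect a b ≠ 0 ∧ ∃ n : ℕ, ∀ l k : ℕ, n ≤ l → n ≤ k → l ≠ k → ∀ d : K,
      ∃ u ∈ N, (u : T) = 1 + d • matrixUnit a b l k := by
  obtain ⟨g, hg, hm, ⟨n₁, h₁⟩, n₂, h₂⟩ := exists_mem_sub_one_annihilated_by_pow hab hgen hN hNc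
  set m : T := g - 1 with hmdef
  have hgm : (g : T) = 1 + m := by rw [hmdef]; abel
  obtain ⟨i, j, c, hc, hij⟩ := exists_entry_ne_zero hab hgen hm h₁ h₂
  refine ⟨fun h => hc (by rw [h, smul_zero]), max n₁ (max (i + 1) (j + 1)), fun l k hl hk hlk d => ?_⟩
  -- From here on `g` is the identity plus a finite matrix `m` with `(i, j)` entry `c`, and
  -- the indices `l` and `k` lie beyond `n₁`, `i` and `j`.
  have hc0 : c ≠ 0 := fun h => hc (by rw [h, zero_smul])
  have hjk : j ≠ k := by omega
  have hkm : ∀ i, matrixUnit a b i k * m = 0 := fun i => by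
    obtain ⟨r, rfl⟩ := Nat.exists_eq_add_of_le (le_of_max_le_left hk)
    rw [matrixUnit, add_comm, pow_add, mul_assoc, mul_assoc (a ^ r), h₁, mul_zero, mul_zero]
  have hsq : ∀ {i j}, i ≠ j → ∀ d : K, d • matrixUnit a b i j * d • matrixUnit a b i j = 0 := by
    intro i j h d
    rw [smul_mul_smul_comm, matrixUnit_mul_matrixUnit hab, if_neg h.symm, smul_zero]
  have hent : matrixUnit a b l i * (m * matrixUnit a b j k) = c • matrixUnit a b l k := by
    have h : matrixUnit a b l i * (m * matrixUnit a b j k) =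
        b ^ l * (defect a b * a ^ i * m * (b ^ j * defect a b)) * a ^ k := by
      simp only [matrixUnit, mul_assoc]
    rw [h, hij, mul_smul_comm, smul_mul_assoc, matrixUnit]
  -- The commutator of `g` with `1 + e_{jk}` is `1` plus the `j`-th column of `m` moved to column `k`.
  obtain ⟨u, hu, huv⟩ : ∃ u ∈ N, (u : T) = 1 + m * matrixUnit a b j k := by
    refine hN.exists_mem_val_eq_of_mul_eq hg
      (unitOneAdd (matrixUnit a b j k) (by simpa using hsq hjk 1)) ?_
    have e1 : matrixUnit a b j k * matrixUnit a b j k = 0 := by simpa using hsq hjk 1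
    have e2 := hkm j
    rw [hgm, unitOneAdd, Units.val_mk]
    simp only [mul_add, add_mul, mul_one, one_mul, mul_assoc, e1, e2, mul_zero, add_zero]
    abel
  have hli : l ≠ i := by omega
  -- The commutator of `1 + c⁻¹ d e_{li}` with `u` moves the entry `c` to row `l`, rescaled to `d`.
  refine hN.exists_mem_val_eq_of_mul_eq' hu
    (unitOneAdd ((c⁻¹ * d) • matrixUnit a b l i) (hsq hli _)) ?_
  have e1 : (c⁻¹ * d) • matrixUnit a b l i * (m * matrixUnit a b j k) =
      d • matrixUnit a b l k := by
    rw [smul_mul_assoc, hent, smul_smul, mul_right_comm, inv_mul_cancel₀ hc0, one_mul]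
  have e2 : m * matrixUnit a b j k * (c⁻¹ * d) • matrixUnit a b l i = 0 := by
    rw [mul_smul_comm, mul_assoc, matrixUnit_mul_matrixUnit hab, if_neg hlk.symm, mul_zero,
      smul_zero]
  have e3 : d • matrixUnit a b l k * (m * matrixUnit a b j k) = 0 := by
    rw [smul_mul_assoc, ← mul_assoc, hkm, zero_mul, smul_zero]
  have e4 : d • matrixUnit a b l k * (c⁻¹ * d) • matrixUnit a b l i = 0 := by
    rw [smul_mul_smul_comm, matrixUnit_mul_matrixUnit hab, if_neg hlk.symm, smul_zero]
  rw [huv, unitOneAdd, Units.val_mk]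
  simp only [mul_add, add_mul, mul_one, one_mul, e1, e2, e3, e4, add_zero]
  abel

/-- A 2-by-2 matrix placed in rows and columns `n` and `n + 1`. -/
def blockMap (a b : T) (n : ℕ) (M : Matrix (Fin 2) (Fin 2) K) : T :=
  ∑ i : Fin 2, ∑ j : Fin 2, M i j • matrixUnit a b (n + i) (n + j)

theorem blockMap_sub (n : ℕ) (M M' : Matrix (Fin 2) (Fin 2) K) :
    blockMap a b n (M - M') = blockMap a b n M - blockMap a b n M' := by
  simp only [blockMap, Matrix.sub_apply, sub_smul, Finset.sum_sub_distrib]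

theorem blockMap_mul (hab : a * b = 1) (n : ℕ) (M M' : Matrix (Fin 2) (Fin 2) K) :
    blockMap a b n (M * M') = blockMap a b n M * blockMap a b n M' := by
  simp only [blockMap, Fin.sum_univ_two, mul_add, add_mul, smul_mul_smul_comm,
    matrixUnit_mul_matrixUnit hab, Matrix.mul_apply, add_smul]
  simp
  abel

theorem blockMap_injective (hab : a * b = 1) (hv : defect a b ≠ 0) (n : ℕ) :
    Function.Injective (blockMap (K := K) a b n) := by
  intro M M' h
  rw [← sub_eq_zero, ← blockMap_sub] at h
  ext i j
  have h2 : matrixUnit a b (n + i) (n + i) * blockMap a b n (M - M') *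
      matrixUnit a b (n + j) (n + j) = (M - M') i j • matrixUnit a b (n + i) (n + j) := by
    fin_cases i <;> fin_cases j <;>
      simp [blockMap, mul_add, add_mul, matrixUnit_mul_matrixUnit hab]
  rw [h, mul_zero, zero_mul, eq_comm,
    smul_eq_zero_iff_left (matrixUnit_ne_zero hab hv _ _)] at h2
  exact sub_eq_zero.1 h2

/-- A 2-by-2 matrix placed in rows and columns `n` and `n + 1` of the infinite identity matrix. -/
def blockHom (hab : a * b = 1) (n : ℕ) : Matrix (Fin 2) (Fin 2) K →* T where
  toFun M := 1 + blockMap a b n (M - 1)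
  map_one' := by simp [blockMap]
  map_mul' M M' := by
    have h : M * M' - 1 = (M - 1) * (M' - 1) - (1 - M) - (1 - M') := by noncomm_ring
    have h1 : ∀ M : Matrix (Fin 2) (Fin 2) K,
        blockMap a b n (1 - M) = - blockMap a b n (M - 1) := fun M => by
      rw [blockMap_sub, blockMap_sub, neg_sub]
    rw [h, blockMap_sub, blockMap_sub, blockMap_mul hab, h1, h1]
    noncomm_ring

/-- The unit group of any algebra generated by `a` and `b` with `a * b = 1` has free noncyclic
subgroups in all its noncentral normal subgroups. If also `b * a = 1`, the claim is vacuous, as the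
algebra is then commutative. -/
theorem exists_free_subgroup_of_not_le_center (hK : ¬ IsAbsoluteField K)
    (hab : a * b = 1) (hgen : Algebra.adjoin K {a, b} = ⊤)
    {N : Subgroup Tˣ} (hN : N.Normal) (hNc : ¬ N ≤ Subgroup.center Tˣ) :
    ∃ H : Subgroup Tˣ, H ≤ N ∧ IsFreeGroup H ∧ ¬ IsCyclic H := by
  obtain ⟨hv, n, hn⟩ := exists_forall_transvection_mem hab hgen hN hNc
  let φ : GL (Fin 2) K →* Tˣ := Units.map (blockHom hab n)
  have hφ : Function.Injective φ := Units.map_injective fun M M' h =>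
    sub_left_injective (blockMap_injective hab hv n (add_left_cancel h))
  have hmem : ∀ {x : Tˣ} {w : T}, (∃ u ∈ N, (u : T) = w) → (x : T) = w → x ∈ N := by
    rintro x w ⟨u, hu, rfl⟩ h
    rwa [Units.ext h]
  have := hN.comap φ
  obtain ⟨f, hf, hfN⟩ := exists_free_subgroup_of_transvections_mem hK (N.comap φ)
    (fun d => hmem (hn n (n + 1) le_rfl n.le_succ n.lt_succ_self.ne d)
      (by simp [φ, blockHom, blockMap, upperTransvection, Fin.sum_univ_two]))
    (fun d => hmem (hn (n + 1) n n.le_succ le_rfl n.lt_succ_self.ne' d)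
      (by simp [φ, blockHom, blockMap, lowerTransvection, Fin.sum_univ_two]))
  refine ⟨(φ.comp f).range, ?_, isFreeGroup_range_and_not_isCyclic (φ.comp f) (hφ.comp hf)⟩
  rw [MonoidHom.range_comp, Subgroup.map_le_iff_le_comap]
  exact hfN
end Jacobson

/-! ### The Toeplitz algebra -/

section Toeplitz

open LeavittPathAlgebra ToeplitzVertex ToeplitzEdge

variable (K : Type*) [Field K]

/-- The image of a generating symbol in the Toeplitz algebra. -/
def toeplitzGen (x : Gen ToeplitzVertex ToeplitzEdge) : ToeplitzAlgebra K :=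
  RingQuot.mkAlgHom K (Rel K toeplitzGraph) (FreeAlgebra.ι K x)

/-- The backward shift `e* + f*`, a left inverse of the forward shift. -/
def toeplitzBackward : ToeplitzAlgebra K :=
  toeplitzGen K (.ghost e) + toeplitzGen K (.ghost f)

/-- The forward shift `e + f`. -/
def toeplitzForward : ToeplitzAlgebra K :=
  toeplitzGen K (.edge e) + toeplitzGen K (.edge f)

variable {K}

theorem toeplitzGen_edge_mul_range (x : ToeplitzEdge) :
    toeplitzGen K (.edge x) * toeplitzGen K (.vertex (toeplitzGraph.r x)) =
      toeplitzGen K (.edge x) := by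
  simpa [vtx, edg, toeplitzGen] using
    RingQuot.mkAlgHom_rel K (Rel.edge_mul_range (K := K) (G := toeplitzGraph) x)

theorem toeplitzGen_range_mul_ghost (x : ToeplitzEdge) :
    toeplitzGen K (.vertex (toeplitzGraph.r x)) * toeplitzGen K (.ghost x) =
      toeplitzGen K (.ghost x) := by
  simpa [vtx, gst, toeplitzGen] using
    RingQuot.mkAlgHom_rel K (Rel.range_mul_ghost (K := K) (G := toeplitzGraph) x)

theorem toeplitzGen_ghost_mul_edge_self (x : ToeplitzEdge) :
    toeplitzGen K (.ghost x) * toeplitzGen K (.edge x) =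
      toeplitzGen K (.vertex (toeplitzGraph.r x)) := by
  simpa [vtx, edg, gst, toeplitzGen] using
    RingQuot.mkAlgHom_rel K (Rel.ghost_mul_edge_self (K := K) (G := toeplitzGraph) x)

theorem toeplitzGen_ghost_mul_edge_of_ne {x y : ToeplitzEdge} (h : x ≠ y) :
    toeplitzGen K (.ghost x) * toeplitzGen K (.edge y) = 0 := by
  simpa [edg, gst, toeplitzGen] using
    RingQuot.mkAlgHom_rel K (Rel.ghost_mul_edge_of_ne (K := K) (G := toeplitzGraph) x y h)

theorem toeplitzGen_vertex_mul_of_ne {x y : ToeplitzVertex} (h : x ≠ y) :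
    toeplitzGen K (.vertex x) * toeplitzGen K (.vertex y) = 0 := by
  simpa [vtx, toeplitzGen] using
    RingQuot.mkAlgHom_rel K (Rel.vertex_mul_of_ne (K := K) (G := toeplitzGraph) x y h)

theorem toeplitzGen_u_add_v :
    toeplitzGen K (.vertex u) + toeplitzGen K (.vertex v) = 1 := by
  have h : (Finset.univ : Finset ToeplitzVertex) = {u, v} := rfl
  simpa [vtx, toeplitzGen, h] using
    RingQuot.mkAlgHom_rel K (Rel.sum_vertices (K := K) (G := toeplitzGraph))

theorem toeplitzGraph_isRegular_u : toeplitzGraph.IsRegular u := by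
  have : Finite ToeplitzEdge := Finite.of_surjective (fun b : Bool => cond b e f)
    (by rintro (_ | _); exacts [⟨true, rfl⟩, ⟨false, rfl⟩])
  exact ⟨⟨e, rfl⟩, Set.toFinite _⟩

theorem toeplitzGen_u_eq :
    toeplitzGen K (.vertex u) = toeplitzGen K (.edge e) * toeplitzGen K (.ghost e) +
      toeplitzGen K (.edge f) * toeplitzGen K (.ghost f) := by
  classical
  have hne : e ≠ f := by rintro ⟨⟩
  have h : toeplitzGraph_isRegular_u.2.toFinset = {e, f} := by
    ext x
    cases x <;> simp [toeplitzGraph]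
  have h2 := RingQuot.mkAlgHom_rel K
    (Rel.regular (K := K) (G := toeplitzGraph) u toeplitzGraph_isRegular_u)
  rw [h, Finset.sum_pair hne] at h2
  simpa [vtx, edg, gst, toeplitzGen] using h2

theorem toeplitzBackward_mul_forward : toeplitzBackward K * toeplitzForward K = 1 := by
  rw [toeplitzBackward, toeplitzForward, add_mul, mul_add, mul_add,
    toeplitzGen_ghost_mul_edge_self, toeplitzGen_ghost_mul_edge_self,
    toeplitzGen_ghost_mul_edge_of_ne (by rintro ⟨⟩), toeplitzGen_ghost_mul_edge_of_ne (by rintro ⟨⟩),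
    add_zero, zero_add]
  exact toeplitzGen_u_add_v

theorem toeplitzGen_edge_mul_vertex (x : ToeplitzEdge) {w : ToeplitzVertex}
    (h : toeplitzGraph.r x ≠ w) : toeplitzGen K (.edge x) * toeplitzGen K (.vertex w) = 0 := by
  rw [← toeplitzGen_edge_mul_range, mul_assoc, toeplitzGen_vertex_mul_of_ne h, mul_zero]

theorem toeplitzGen_vertex_mul_ghost (x : ToeplitzEdge) {w : ToeplitzVertex}
    (h : w ≠ toeplitzGraph.r x) : toeplitzGen K (.vertex w) * toeplitzGen K (.ghost x) = 0 := by
  rw [← toeplitzGen_range_mul_ghost, ← mul_assoc, toeplitzGen_vertex_mul_of_ne h, zero_mul]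

theorem toeplitzGen_edge_mul_ghost_of_ne {x y : ToeplitzEdge}
    (h : toeplitzGraph.r x ≠ toeplitzGraph.r y) :
    toeplitzGen K (.edge x) * toeplitzGen K (.ghost y) = 0 := by
  rw [← toeplitzGen_range_mul_ghost, ← mul_assoc, toeplitzGen_edge_mul_vertex x h, zero_mul]

theorem toeplitzForward_mul_backward :
    toeplitzForward K * toeplitzBackward K = toeplitzGen K (.vertex u) := by
  rw [toeplitzBackward, toeplitzForward, add_mul, mul_add, mul_add,
    toeplitzGen_edge_mul_ghost_of_ne (x := e) (y := f) (by rintro ⟨⟩),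
    toeplitzGen_edge_mul_ghost_of_ne (x := f) (y := e) (by rintro ⟨⟩), add_zero, zero_add, toeplitzGen_u_eq]

/-- With `b = e + f` and `a = e* + f*` one has `u = b a`, `v = 1 - b a`, `e = b u`, `f = b v`, `e* = u a`
and `f* = v a`. -/
theorem toeplitz_adjoin_eq_top :
    Algebra.adjoin K {toeplitzBackward K, toeplitzForward K} = ⊤ := by
  set S := Algebra.adjoin K {toeplitzBackward K, toeplitzForward K}
  have ha : toeplitzBackward K ∈ S := Algebra.subset_adjoin (by simp)
  have hb : toeplitzForward K ∈ S := Algebra.subset_adjoin (by simp)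
  have hu : toeplitzGen K (.vertex u) ∈ S := toeplitzForward_mul_backward (K := K) ▸ mul_mem hb ha
  have hv : toeplitzGen K (.vertex v) ∈ S := by
    rw [← add_sub_cancel_left (toeplitzGen K (.vertex u)) (toeplitzGen K (.vertex v)),
      toeplitzGen_u_add_v]
    exact sub_mem (one_mem _) hu
  have hr : ∀ w, toeplitzGen K (.vertex w) ∈ S := by rintro (_ | _) <;> assumption
  have hedge : ∀ x, toeplitzGen K (.edge x) =
      toeplitzForward K * toeplitzGen K (.vertex (toeplitzGraph.r x)) := by
    rintro (_ | _) <;> rw [toeplitzForward, add_mul, toeplitzGen_edge_mul_range]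
    · rw [toeplitzGen_edge_mul_vertex f (by rintro ⟨⟩), add_zero]
    · rw [toeplitzGen_edge_mul_vertex e (by rintro ⟨⟩), zero_add]
  have hghost : ∀ x, toeplitzGen K (.ghost x) =
      toeplitzGen K (.vertex (toeplitzGraph.r x)) * toeplitzBackward K := by
    rintro (_ | _) <;> rw [toeplitzBackward, mul_add, toeplitzGen_range_mul_ghost]
    · rw [toeplitzGen_vertex_mul_ghost f (by rintro ⟨⟩), add_zero]
    · rw [toeplitzGen_vertex_mul_ghost e (by rintro ⟨⟩), zero_add]
  have hgen : ∀ x, toeplitzGen K x ∈ S := by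
    rintro (w | x | x)
    · exact hr w
    · exact hedge x ▸ mul_mem hb (hr _)
    · exact hghost x ▸ mul_mem (hr _) ha
  rw [eq_top_iff]
  intro y _
  obtain ⟨z, rfl⟩ := RingQuot.mkAlgHom_surjective K (Rel K toeplitzGraph) y
  induction z using FreeAlgebra.induction with
  | grade0 r => rw [AlgHom.commutes]; exact S.algebraMap_mem r
  | grade1 x => exact hgen x
  | mul y z hy hz => rw [map_mul]; exact mul_mem (hy trivial) (hz trivial)
  | add y z hy hz => rw [map_add]; exact add_mem (hy trivial) (hz trivial)

end Toeplitz

theorem mainTheorem10 (K : Type*) [Field K] (hK : ¬ IsAbsoluteField K)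
    (N : Subgroup (ToeplitzAlgebra K)ˣ) (hN : N.Normal)
    (hNc : ¬ N ≤ Subgroup.center (ToeplitzAlgebra K)ˣ) :
    ∃ H : Subgroup (ToeplitzAlgebra K)ˣ, H ≤ N ∧ IsFreeGroup H ∧ ¬ IsCyclic H :=
  exists_free_subgroup_of_not_le_center hK toeplitzBackward_mul_forward toeplitz_adjoin_eq_top
    hN hNc
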